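/- Let $\lambda$ be an infinite regular cardinal and $S$ a set. An $S$-sorted $\lambda$-ary signature $\Sigma$ consists of a set of function symbols, each with an arity $f\colon\sqcap_{i<\alpha}s_i\to s$, and a set of relation symbols, each with an arity $R\colon\sqcap_{i<\alpha}s_i$, where $\alpha<\lambda$ and $s_i,s\in S$. Terms are built from sorted variables by function symbols. $\lambda$-ary Horn formulas are built from the atomic formulas $R(\tau_i)_{i<\alpha}$ and $\tau=\tau'$ and from $\top$ by conjunctions of fewer than $\lambda$ formulas. A $\lambda$-ary partial Horn theory $\mathbb{T}$ over $\Sigma$ is a set of sequents $\phi\vdash_{\vec{x}}\psi$, where $\phi,\psi$ are $\lambda$-ary Horn formulas whose variables lie in the context $\vec{x}=(x_i:s_i)_{i<\alpha}$, $\alpha<\lambda$. A partial $\Sigma$-structure $M$ consists of a set $M_s$ for each $s\in S$, a partial map $[\![f]\!]_M\colon\prod_{i<\alpha}M_{s_i}\rightharpoonup M_s$ for each function symbol $f$, and a subset $[\![R]\!]_M\subseteq\prod_{i<\alpha}M_{s_i}$ for each relation symbol $R$. Terms are interpreted as partial maps, a term being defined only if all its subterms are, and Horn formulas as subsets of $\prod_{i<\alpha}M_{s_i}$: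 $R(\tau_i)_i$ (resp. $\tau=\tau'$) holds when all terms involved are defined and their values lie in $[\![R]\!]_M$ (resp. are equal). A partial $\mathbb{T}$-model is a partial $\Sigma$-structure in which $[\![\vec{x}.\phi]\!]_M\subseteq[\![\vec{x}.\psi]\!]_M$ for every sequent $\phi\vdash_{\vec{x}}\psi$ in $\mathbb{T}$. A homomorphism $h\colon M\to N$ is a family of total maps $h_s\colon M_s\to N_s$ such that, whenever $[\![f]\!]_M(\vec{a})$ is defined, $[\![f]\!]_N(h(\vec{a}))$ is defined and equals $h([\![f]\!]_M(\vec{a}))$, and $\vec{a}\in[\![R]\!]_M$ implies $h(\vec{a})\in[\![R]\!]_N$. Let $\mathbf{PMod}\,\mathbb{T}$ be the category of partial $\mathbb{T}$-models and homomorphisms. A monomorphism $h\colon A\to B$ in $\mathbf{PMod}\,\mathbb{T}$ is called $\mathbb{T}$-closed if, for all function symbols $f$ and relation symbols $R$ and all tuples $\vec{a}$ in $A$ of the appropriate sorts, $[\![f]\!]_A(\vec{a})$ is defined if and only if $[\![f]\!]_B(h(\vec{a}))$ is, and $\vec{a}\in[\![R]\!]_A$ if and only if $h(\vec{a})\in[\![R]\!]_B$.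 A morphism $h\colon A\to B$ is called $\mathbb{T}$-dense if, whenever $h=m\circ g$ with $m$ a $\mathbb{T}$-closed monomorphism, $m$ is an isomorphism. For morphisms $e,m$ of a category write $e\perp m$ if every commutative square $ve=mu$ has a unique diagonal $d$ with $de=u$ and $md=v$. Theorem. Let $\mathbf{E}$ be the class of all $\mathbb{T}$-dense morphisms and $\mathbf{M}$ the class of all $\mathbb{T}$-closed monomorphisms in $\mathbf{PMod}\,\mathbb{T}$. Then $(\mathbf{E},\mathbf{M})$ is a $\lambda$-presentable proper factorization system in $\mathbf{PMod}\,\mathbb{T}$. That is: 1. $\mathbf{E}$ and $\mathbf{M}$ are closed under composition and contain all isomorphisms; every morphism $f$ has a factorization $f=m\circ e$ with $e\in\mathbf{E}$ and $m\in\mathbf{M}$; and $e\perp m$ for all $e\in\mathbf{E}$, $m\in\mathbf{M}$. 2. Every morphism in $\mathbf{E}$ is an epimorphism and every morphism in $\mathbf{M}$ is a monomorphism. 3. If a morphism $m$ satisfies $e\perp m$ for every $e\in\mathbf{E}$ whose domain and codomain are $\lambda$-presentable objects of $\mathbf{PMod}\,\mathbb{T}$, then $m\in\mathbf{M}$. 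-/

import Mathlib

universe w v u

namespace PartialHorn

open CategoryTheory

/-! ### Signatures, terms, Horn formulas -/

/-- A family `(s_i)_{i < α}` of sorts with `α < κ`. An ordinal `α < κ` is given as an element
of the well-ordered type `κ.ord.ToType`, and `{i | i < α}` is then the initial segment
`Set.Iio α`. Such families serve as arities of symbols, and as contexts
`(x_i : s_i)_{i < α}`, whose `i`-th variable is represented by the position `i`. -/
structure SortFamily (κ : Cardinal.{w}) (S : Type w) : Type w where
  length : κ.ord.ToType
  sort : Set.Iio length → S

/-- An `S`-sorted `κ`-ary signature. -/
structure Signature (κ : Cardinal.{w}) (S : Type w) : Type (w + 1) where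
  Fn : Type w
  Rel : Type w
  fnArity : Fn → SortFamily κ S
  fnSort : Fn → S
  relArity : Rel → SortFamily κ S

variable {κ : Cardinal.{w}} {S : Type w}

/-- Terms in the context `x`, indexed by their type. -/
inductive Term (Sig : Signature κ S) (x : SortFamily κ S) : S → Type w
  | var (i : Set.Iio x.length) : Term Sig x (x.sort i)
  | app (f : Sig.Fn) (τ : ∀ i : Set.Iio (Sig.fnArity f).length,
      Term Sig x ((Sig.fnArity f).sort i)) : Term Sig x (Sig.fnSort f)

/-- `κ`-ary Horn formulas in the context `x`. -/
inductive HornFormula (Sig : Signature κ S) (x : SortFamily κ S) : Type w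
  | rel (R : Sig.Rel) (τ : ∀ i : Set.Iio (Sig.relArity R).length,
      Term Sig x ((Sig.relArity R).sort i)) : HornFormula Sig x
  | eq {s : S} (τ τ' : Term Sig x s) : HornFormula Sig x
  | top : HornFormula Sig x
  | conj (α : κ.ord.ToType) (φ : Set.Iio α → HornFormula Sig x) : HornFormula Sig x

/-- Horn sequents `φ ⊢_x ψ`. -/
structure HornSequent (Sig : Signature κ S) : Type w where
  ctx : SortFamily κ S
  lhs : HornFormula Sig ctx
  rhs : HornFormula Sig ctx

/-- A `κ`-ary partial Horn theory over `Sig`. -/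
abbrev Theory (Sig : Signature κ S) : Type w := Set (HornSequent Sig)

/-! ### Partial structures and homomorphisms -/

/-- Partial structures: `α →. β` is the type of partial maps from `α` to `β`. -/
structure PStr (Sig : Signature κ S) : Type (w + 1) where
  carrier : S → Type w
  fn (f : Sig.Fn) :
    (∀ i, carrier ((Sig.fnArity f).sort i)) →. carrier (Sig.fnSort f)
  rel (R : Sig.Rel) : Set (∀ i, carrier ((Sig.relArity R).sort i))

variable {Sig : Signature κ S}

/-- The partial map interpreting a term in context. The term `f(τ_j)_j` is defined iff all the
`τ_j` are defined and `f` is defined at the tuple of their values. -/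
def Term.eval (M : PStr Sig) {x : SortFamily κ S} (m : ∀ i, M.carrier (x.sort i)) :
    {s : S} → Term Sig x s → Part (M.carrier s)
  | _, .var i => Part.some (m i)
  | _, .app f τ => Part.assert (∀ j, ((τ j).eval M m).Dom)
      fun h => M.fn f fun j => ((τ j).eval M m).get (h j)

/-- `φ.Holds M m` means that `m` belongs to the interpretation of `φ` in `M`. -/
def HornFormula.Holds (M : PStr Sig) {x : SortFamily κ S} (m : ∀ i, M.carrier (x.sort i)) :
    HornFormula Sig x → Prop
  | .rel R τ => ∃ h : ∀ j, ((τ j).eval M m).Dom,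
      (fun j => ((τ j).eval M m).get (h j)) ∈ M.rel R
  | .eq τ τ' => ∃ a, a ∈ τ.eval M m ∧ a ∈ τ'.eval M m
  | .top => True
  | .conj _ φ => ∀ j, (φ j).Holds M m

/-- Validity of a Horn sequent in a partial structure. -/
def HornSequent.Valid (M : PStr Sig) (σ : HornSequent Sig) : Prop :=
  ∀ m : ∀ i, M.carrier (σ.ctx.sort i), σ.lhs.Holds M m → σ.rhs.Holds M m

/-- Homomorphisms of partial structures: if `f` is defined at `a` in `M` with value `b`, then
`f` is defined at `h a` in `N` with value `h b`; and relations are preserved. -/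
@[ext]
structure PStr.Hom (M N : PStr Sig) : Type w where
  toFun (s : S) : M.carrier s → N.carrier s
  map_fn (f : Sig.Fn) (a : ∀ i, M.carrier ((Sig.fnArity f).sort i))
    (b : M.carrier (Sig.fnSort f)) :
    b ∈ M.fn f a → toFun _ b ∈ N.fn f fun i => toFun _ (a i)
  map_rel (R : Sig.Rel) (a : ∀ i, M.carrier ((Sig.relArity R).sort i)) :
    a ∈ M.rel R → (fun i => toFun _ (a i)) ∈ N.rel R

/-- The category of partial structures. -/
instance : Category.{w} (PStr Sig) where
  Hom := PStr.Hom
  id M := ⟨fun _ a => a, fun _ _ _ h => h, fun _ _ h => h⟩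
  comp g h := ⟨fun s a => h.toFun s (g.toFun s a),
    fun f _ _ hb => h.map_fn f _ _ (g.map_fn f _ _ hb),
    fun R _ ha => h.map_rel R _ (g.map_rel R _ ha)⟩

/-- The partial models of a theory. -/
def isModel (T : Theory Sig) : ObjectProperty (PStr Sig) :=
  fun M => ∀ σ ∈ T, σ.Valid M

/-- The category of partial `T`-models, a full subcategory of that of partial structures. -/
abbrev PMod (T : Theory Sig) : Type (w + 1) := (isModel T).FullSubcategory

/-! ### Closed monomorphisms and dense morphisms -/

/-- The class of `T`-closed monomorphisms. The inclusions of the domain of `f` (resp. of the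
relation `R`) into the products form a pullback square precisely when the domain of `f` (resp.
the relation `R`) in `A` is the preimage of the one in `B`. -/
def closedMono (T : Theory Sig) : MorphismProperty (PMod T) := fun A B h =>
  Mono h ∧
  (∀ f : Sig.Fn, (A.obj.fn f).Dom = (fun a i => h.hom.toFun _ (a i)) ⁻¹' (B.obj.fn f).Dom) ∧
  (∀ R : Sig.Rel, A.obj.rel R = (fun a i => h.hom.toFun _ (a i)) ⁻¹' B.obj.rel R)

/-- The class of `T`-dense morphisms: those which factor through no proper `T`-closed subobject
of the codomain. -/
def dense (T : Theory Sig) : MorphismProperty (PMod T) := fun A B h =>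
  ∀ ⦃C : PMod T⦄ (g : A ⟶ C) (m : C ⟶ B), closedMono T m → g ≫ m = h → IsIso m

/-! ### Orthogonal factorization systems -/

section Factorization

variable {C : Type u} [Category.{v} C]

/-- `e ⊥ m`: each commutative square has a unique diagonal filler. -/
def Orthogonal {X Y A B : C} (e : X ⟶ Y) (m : A ⟶ B) : Prop :=
  ∀ (a : X ⟶ A) (b : Y ⟶ B), e ≫ b = a ≫ m → ∃! d : Y ⟶ A, e ≫ d = a ∧ d ≫ m = b

/-- The class `r(Λ)` of all `m` with `e ⊥ m` for all `e` in `Λ`. -/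
def rightOrthogonal (L : MorphismProperty C) : MorphismProperty C :=
  fun _ _ m => ∀ ⦃X Y : C⦄ (e : X ⟶ Y), L e → Orthogonal e m

/-- Orthogonal factorization systems. -/
structure IsOrthogonalFactorizationSystem (E M : MorphismProperty C) : Prop where
  left_comp : E.IsStableUnderComposition
  right_comp : M.IsStableUnderComposition
  left_iso : MorphismProperty.isomorphisms C ≤ E
  right_iso : MorphismProperty.isomorphisms C ≤ M
  factorization : ∀ ⦃X Y : C⦄ (f : X ⟶ Y),
    ∃ (Z : C) (e : X ⟶ Z) (m : Z ⟶ Y), E e ∧ M m ∧ e ≫ m = f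
  orthogonal : ∀ ⦃X Y A B : C⦄ (e : X ⟶ Y) (m : A ⟶ B), E e → M m → Orthogonal e m

/-- Proper factorization systems. -/
structure IsProperFactorizationSystem (E M : MorphismProperty C) : Prop
    extends IsOrthogonalFactorizationSystem E M where
  epi : E ≤ MorphismProperty.epimorphisms C
  mono : M ≤ MorphismProperty.monomorphisms C

/-- The class of those morphisms in `L` whose domain and codomain are `κ`-presentable. -/
def presentablePart (κ : Cardinal.{w}) [Fact κ.IsRegular] (L : MorphismProperty C) :
    MorphismProperty C :=
  fun X Y f => L f ∧ IsCardinalPresentable X κ ∧ IsCardinalPresentable Y κ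

/-- `κ`-presentable proper factorization systems: proper factorization systems `(E, M)` with
`r(E_κ) ⊆ M`. -/
structure IsPresentableProperFactorizationSystem (κ : Cardinal.{w}) [Fact κ.IsRegular]
    (E M : MorphismProperty C) : Prop
    extends IsProperFactorizationSystem E M where
  presentable : rightOrthogonal (presentablePart κ E) ≤ M

end Factorization

end PartialHorn

namespace PartialHorn

open CategoryTheory Limits

variable {κ : Cardinal.{w}} {S : Type w} {Sig : Signature κ S}

/-! ### Evaluation of terms and formulas -/

/-! Horn formulas are preserved by homomorphisms and reflected by families that exhibit a structure
as a substructure of a product (`JointlyReflecting.holds`). Hence a subset of a model closed under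
the partial operations is again a model. Closed monomorphisms are exactly the single reflecting
morphisms (`closedMono_iff`), and dense morphisms are those whose image generates the codomain
(`dense_iff`). Properness and orthogonality then become statements about closed subsets: factor
through the submodel generated by the image, and obtain diagonals and epimorphy by checking that a
preimage or an equalizer is closed.

For presentability, each Horn formula `φ` has a model `rep T φ` representing the functor that sends
a model to its tuples satisfying `φ`. Truth of a formula in a `κ`-filtered colimit is witnessed at
some stage (`exists_stage_holds`), so `rep T φ` is `κ`-presentable. The canonical map from the
representing model of `⊤` to that of `φ` is dense, because the generic tuple generates.
Orthogonality of `m` to this map forces `m` to reflect `φ` (`holds_of_rightOrthogonal`). Taking for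
`φ` an equation between two variables, the definedness of `f(x)`, and `R(x)` shows that `m` is a
closed monomorphism. -/

theorem Term.mem_eval_var (M : PStr Sig) {x : SortFamily κ S} (m : ∀ i, M.carrier (x.sort i))
    (i : Set.Iio x.length) (b : M.carrier (x.sort i)) :
    b ∈ (Term.var (Sig := Sig) i).eval M m ↔ b = m i := by
  simp [Term.eval]

theorem Term.mem_eval_app (M : PStr Sig) {x : SortFamily κ S} (m : ∀ i, M.carrier (x.sort i))
    (f : Sig.Fn) (τ : ∀ i, Term Sig x ((Sig.fnArity f).sort i)) (b : M.carrier (Sig.fnSort f)) :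
    b ∈ (Term.app f τ).eval M m ↔ ∃ a, (∀ j, a j ∈ (τ j).eval M m) ∧ b ∈ M.fn f a := by
  rw [Term.eval, Part.mem_assert_iff]
  constructor
  · rintro ⟨h, hb⟩
    exact ⟨_, fun j => Part.get_mem (h j), hb⟩
  · rintro ⟨a, ha, hb⟩
    refine ⟨fun j => (ha j).1, ?_⟩
    have : (fun j => ((τ j).eval M m).get (ha j).1) = a :=
      funext fun j => Part.get_eq_of_mem (ha j) _
    rwa [this]

theorem HornFormula.holds_rel (M : PStr Sig) {x : SortFamily κ S}
    (m : ∀ i, M.carrier (x.sort i)) (R : Sig.Rel)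
    (τ : ∀ i, Term Sig x ((Sig.relArity R).sort i)) :
    (HornFormula.rel R τ).Holds M m ↔ ∃ a, (∀ j, a j ∈ (τ j).eval M m) ∧ a ∈ M.rel R := by
  rw [HornFormula.Holds]
  constructor
  · rintro ⟨h, hb⟩
    exact ⟨_, fun j => Part.get_mem (h j), hb⟩
  · rintro ⟨a, ha, hb⟩
    refine ⟨fun j => (ha j).1, ?_⟩
    have : (fun j => ((τ j).eval M m).get (ha j).1) = a :=
      funext fun j => Part.get_eq_of_mem (ha j) _
    rwa [this]

theorem HornFormula.holds_eq_self (M : PStr Sig) {x : SortFamily κ S}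
    (m : ∀ i, M.carrier (x.sort i)) {s : S} (τ : Term Sig x s) :
    (HornFormula.eq τ τ).Holds M m ↔ (τ.eval M m).Dom := by
  simp [HornFormula.Holds, Part.dom_iff_mem]

theorem PStr.Hom.map_eval {M N : PStr Sig} (h : M ⟶ N) {x : SortFamily κ S}
    (m : ∀ i, M.carrier (x.sort i)) {s : S} (τ : Term Sig x s) (b : M.carrier s)
    (hb : b ∈ τ.eval M m) : h.toFun s b ∈ τ.eval N fun i => h.toFun _ (m i) := by
  induction τ with
  | var i =>
    rw [Term.mem_eval_var] at hb ⊢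
    rw [hb]
  | app f τ ih =>
    rw [Term.mem_eval_app] at hb ⊢
    obtain ⟨a, ha, hb⟩ := hb
    exact ⟨_, fun j => ih j _ (ha j), h.map_fn f a b hb⟩

theorem PStr.Hom.map_holds {M N : PStr Sig} (h : M ⟶ N) {x : SortFamily κ S}
    (m : ∀ i, M.carrier (x.sort i)) (φ : HornFormula Sig x)
    (hφ : φ.Holds M m) : φ.Holds N fun i => h.toFun _ (m i) := by
  induction φ with
  | rel R τ =>
    rw [HornFormula.holds_rel] at hφ ⊢
    obtain ⟨a, ha, hR⟩ := hφ
    exact ⟨_, fun j => PStr.Hom.map_eval h m _ _ (ha j), h.map_rel R a hR⟩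
  | eq τ τ' =>
    obtain ⟨a, h1, h2⟩ := hφ
    exact ⟨_, PStr.Hom.map_eval h m _ _ h1, PStr.Hom.map_eval h m _ _ h2⟩
  | top => trivial
  | conj α φ ih => exact fun j => ih j (hφ j)

theorem PStr.hom_ext {M N : PStr Sig} {g h : M ⟶ N} (H : ∀ s a, g.toFun s a = h.toFun s a) :
    g = h :=
  PStr.Hom.ext (funext fun s => funext fun a => H s a)

theorem PMod.hom_ext {T : Theory Sig} {M N : PMod T} {g h : M ⟶ N}
    (H : ∀ s a, g.hom.toFun s a = h.hom.toFun s a) : g = h :=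
  ObjectProperty.hom_ext _ (PStr.hom_ext H)

/-! ### Families of homomorphisms reflecting the structure -/

/-- A family of homomorphisms `h i : F ⟶ N i` exhibiting `F` as a substructure, with the induced
partial functions and relations, of the product of the structures `N i`. -/
structure JointlyReflecting {I : Type u} {F : PStr Sig} {N : I → PStr Sig}
    (h : ∀ i, F ⟶ N i) : Prop where
  inj : ∀ s (a b : F.carrier s), (∀ i, (h i).toFun s a = (h i).toFun s b) → a = b
  dom : ∀ f a, (∀ i, ((N i).fn f fun j => (h i).toFun _ (a j)).Dom) → (F.fn f a).Dom
  rel : ∀ R a, (∀ i, (fun j => (h i).toFun _ (a j)) ∈ (N i).rel R) → a ∈ F.rel R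

namespace JointlyReflecting

variable {I : Type u} {F : PStr Sig} {N : I → PStr Sig} {h : ∀ i, F ⟶ N i}

/-- Once the arguments are defined in `F`, their images must be the values computed in each `N i`,
by uniqueness of values; so `H.dom` applies at the outermost symbol. -/
theorem eval_dom (H : JointlyReflecting h) {x : SortFamily κ S}
    (m : ∀ i, F.carrier (x.sort i)) {s : S} (τ : Term Sig x s)
    (hτ : ∀ i, (τ.eval (N i) fun j => (h i).toFun _ (m j)).Dom) : (τ.eval F m).Dom := by
  induction τ with
  | var i => trivial
  | app f τ ih =>
    simp only [Part.dom_iff_mem, Term.mem_eval_app] at hτ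
    choose y a ha hy using hτ
    have hd : ∀ j, ((τ j).eval F m).Dom := fun j => ih j fun i => (ha i j).1
    have hF : (F.fn f fun j => ((τ j).eval F m).get (hd j)).Dom := by
      refine H.dom _ _ fun i => ?_
      have : (fun j => (h i).toFun _ (((τ j).eval F m).get (hd j))) = a i := funext fun j =>
        Part.mem_unique (PStr.Hom.map_eval (h i) m _ _ (Part.get_mem _)) (ha i j)
      rw [this]
      exact (hy i).1
    exact Part.dom_iff_mem.2 ⟨_, (Term.mem_eval_app ..).2
      ⟨_, fun j => Part.get_mem (hd j), Part.get_mem hF⟩⟩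

theorem holds (H : JointlyReflecting h) {x : SortFamily κ S}
    (m : ∀ i, F.carrier (x.sort i)) (φ : HornFormula Sig x)
    (hφ : ∀ i, φ.Holds (N i) fun j => (h i).toFun _ (m j)) : φ.Holds F m := by
  induction φ with
  | rel R τ =>
    simp only [HornFormula.holds_rel] at hφ ⊢
    choose a ha hR using hφ
    have hd : ∀ j, ((τ j).eval F m).Dom := fun j => H.eval_dom m _ fun i => (ha i j).1
    refine ⟨_, fun j => Part.get_mem (hd j), H.rel _ _ fun i => ?_⟩
    convert hR i using 1
    exact funext fun j =>
      Part.mem_unique (PStr.Hom.map_eval (h i) m _ _ (Part.get_mem _)) (ha i j)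
  | eq τ τ' =>
    simp only [HornFormula.Holds] at hφ ⊢
    choose a h1 h2 using hφ
    have hd : (τ.eval F m).Dom := H.eval_dom m _ fun i => (h1 i).1
    have hd' : (τ'.eval F m).Dom := H.eval_dom m _ fun i => (h2 i).1
    refine ⟨_, Part.get_mem hd, ?_⟩
    have : (τ.eval F m).get hd = (τ'.eval F m).get hd' := H.inj _ _ _ fun i =>
      (Part.mem_unique (PStr.Hom.map_eval (h i) m _ _ (Part.get_mem _)) (h1 i)).trans
        (Part.mem_unique (PStr.Hom.map_eval (h i) m _ _ (Part.get_mem _)) (h2 i)).symm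
    rw [this]
    exact Part.get_mem hd'
  | top => trivial
  | conj α φ ih => exact fun j => ih j fun i => hφ i j

/-- The premise of a sequent is pushed forward to every `N i`, and the conclusion is reflected back.
-/
theorem isModel (H : JointlyReflecting h) {T : Theory Sig} (hN : ∀ i, isModel T (N i)) :
    isModel T F := fun σ hσ m hm =>
  H.holds m _ fun i => hN i σ hσ _ (PStr.Hom.map_holds (h i) m _ hm)

end JointlyReflecting

/-- The partial element determined by a predicate with at most one witness. -/
noncomputable def partOf {β : Type w} (r : β → Prop) : Part β :=
  ⟨∃ b, r b, fun h => h.choose⟩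

theorem mem_partOf {β : Type w} {r : β → Prop} (h : ∀ b b', r b → r b' → b = b') {b : β} :
    b ∈ partOf r ↔ r b := by
  constructor
  · rintro ⟨hd, rfl⟩
    exact hd.choose_spec
  · exact fun hb => ⟨⟨b, hb⟩, h _ _ (Exists.choose_spec (⟨b, hb⟩ : ∃ b, r b)) hb⟩

/-! ### Closed substructures -/

/-- Subsets of a partial structure closed under the partial functions. -/
def FnClosed (M : PStr Sig) (P : ∀ s, Set (M.carrier s)) : Prop :=
  ∀ f a b, (∀ i, a i ∈ P _) → b ∈ M.fn f a → b ∈ P _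

/-- The substructure, with the induced partial functions and relations, on a closed subset. -/
def PStr.sub (M : PStr Sig) (P : ∀ s, Set (M.carrier s)) (hP : FnClosed M P) : PStr Sig where
  carrier s := P s
  fn f a := ⟨(M.fn f fun i => a i).Dom, fun h => ⟨(M.fn f fun i => a i).get h,
    hP f (fun i => a i) _ (fun i => (a i).2) (Part.get_mem h)⟩⟩
  rel R := {a | (fun i => (a i).1) ∈ M.rel R}

/-- The inclusion of a closed substructure. -/
def PStr.subι (M : PStr Sig) (P : ∀ s, Set (M.carrier s)) (hP : FnClosed M P) :
    M.sub P hP ⟶ M :=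
  PStr.Hom.mk (fun _ a => a.1) (by rintro f a _ ⟨h, rfl⟩; exact ⟨h, rfl⟩)
    (fun _ _ h => h)

theorem PStr.subι_reflecting (M : PStr Sig) (P : ∀ s, Set (M.carrier s)) (hP : FnClosed M P) :
    JointlyReflecting fun _ : Unit => M.subι P hP where
  inj _ _ _ h := Subtype.ext (h ())
  dom _ _ h := h ()
  rel _ _ h := h ()

variable {T : Theory Sig}

/-- The closed submodel of a model on a closed subset. -/
def PMod.sub (M : PMod T) (P : ∀ s, Set (M.obj.carrier s)) (hP : FnClosed M.obj P) : PMod T :=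
  ⟨M.obj.sub P hP, (M.obj.subι_reflecting P hP).isModel fun _ => M.property⟩

/-- The inclusion of a closed submodel. -/
def PMod.subι (M : PMod T) (P : ∀ s, Set (M.obj.carrier s)) (hP : FnClosed M.obj P) :
    M.sub P hP ⟶ M :=
  ObjectProperty.homMk (M.obj.subι P hP)

/-- The factorization through a closed submodel of a morphism landing in it. -/
def PMod.subLift {A M : PMod T} (P : ∀ s, Set (M.obj.carrier s)) (hP : FnClosed M.obj P)
    (h : A ⟶ M) (hh : ∀ s a, h.hom.toFun s a ∈ P s) : A ⟶ M.sub P hP :=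
  ObjectProperty.homMk (PStr.Hom.mk (fun s a => ⟨h.hom.toFun s a, hh s a⟩)
    (fun f a b hb => by
      obtain ⟨hd, hv⟩ := h.hom.map_fn f a b hb
      exact ⟨hd, Subtype.ext hv⟩)
    (fun R a ha => h.hom.map_rel R a ha))

/-- The closed subset generated by a subset. -/
inductive Generated (M : PStr Sig) (P : ∀ s, Set (M.carrier s)) : ∀ s, M.carrier s → Prop
  | base {s : S} (a : M.carrier s) (h : a ∈ P s) : Generated M P s a
  | fn (f : Sig.Fn) (a : ∀ i, M.carrier ((Sig.fnArity f).sort i)) (b : M.carrier (Sig.fnSort f))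
    (ha : ∀ i, Generated M P _ (a i)) (hb : b ∈ M.fn f a) : Generated M P _ b

theorem FnClosed.eval_mem {M : PStr Sig} {P : ∀ s, Set (M.carrier s)} (hP : FnClosed M P)
    {x : SortFamily κ S} (m : ∀ i, M.carrier (x.sort i)) (hm : ∀ i, m i ∈ P _)
    {s : S} (τ : Term Sig x s) (b : M.carrier s) (hb : b ∈ τ.eval M m) : b ∈ P s := by
  induction τ with
  | var i =>
    rw [Term.mem_eval_var] at hb
    exact hb ▸ hm i
  | app f τ ih =>
    rw [Term.mem_eval_app] at hb
    obtain ⟨a, ha, hb⟩ := hb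
    exact hP f a b (fun i => ih i _ (ha i)) hb

theorem FnClosed.range {A B : PStr Sig} (h : A ⟶ B)
    (hd : ∀ f a, (B.fn f fun j => h.toFun _ (a j)).Dom → (A.fn f a).Dom) :
    FnClosed B fun s => Set.range (h.toFun s) := by
  intro f a b ha hb
  choose a' ha' using ha
  obtain rfl := funext ha'
  exact ⟨_, Part.mem_unique (h.map_fn f a' _ (Part.get_mem (hd f a' hb.1))) hb⟩

theorem FnClosed.preimage {A B : PStr Sig} (h : A ⟶ B) {P : ∀ s, Set (B.carrier s)}
    (hP : FnClosed B P) : FnClosed A fun s => h.toFun s ⁻¹' P s :=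
  fun f _ _ ha hb => hP f _ _ ha (h.map_fn f _ _ hb)

theorem FnClosed.equalizer {A B : PStr Sig} (g h : A ⟶ B) :
    FnClosed A fun s => {a | g.toFun s a = h.toFun s a} := by
  intro f a b ha hb
  have h1 := g.map_fn f a b hb
  rw [funext ha] at h1
  exact Part.mem_unique h1 (h.map_fn f a b hb)

/-- Bijectivity alone does not suffice: the inverse is a homomorphism only because `h` reflects
definedness and relations. -/
theorem isIso_of_bijective {A B : PMod T} (h : A ⟶ B)
    (hi : JointlyReflecting fun _ : Unit => h.hom)
    (hs : ∀ s, Function.Surjective (h.hom.toFun s)) : IsIso h := by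
  choose g hg using hs
  have hg' : ∀ s a, g s (h.hom.toFun s a) = a := fun s a => hi.inj _ _ _ fun _ => hg s _
  let k : B ⟶ A := ObjectProperty.homMk (PStr.Hom.mk g
    (fun f a b hb => by
      have ha : (fun i => h.hom.toFun _ (g _ (a i))) = a := funext fun i => hg _ _
      have hd : (A.obj.fn f fun i => g _ (a i)).Dom := hi.dom _ _ fun _ => by
        rw [ha]
        exact hb.1
      have hv := h.hom.map_fn f _ _ (Part.get_mem hd)
      rw [ha] at hv
      rw [← Part.mem_unique hv hb, hg']
      exact Part.get_mem hd)
    (fun R a ha => hi.rel _ _ fun _ => by simpa only [hg] using ha))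
  exact ⟨k, PMod.hom_ext hg', PMod.hom_ext hg⟩

/-! ### Models representing Horn formulas -/

variable {x : SortFamily κ S}

/-- Semantic entailment between Horn formulas in the same context. -/
def Entails (T : Theory Sig) (φ ψ : HornFormula Sig x) : Prop :=
  ∀ (N : PMod T) (m : ∀ i, N.obj.carrier (x.sort i)), φ.Holds N.obj m → ψ.Holds N.obj m

theorem Entails.eq_symm {φ : HornFormula Sig x} {s : S} {t t' : Term Sig x s}
    (h : Entails T φ (.eq t t')) : Entails T φ (.eq t' t) := fun N m hm => by
  obtain ⟨a, h1, h2⟩ := h N m hm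
  exact ⟨a, h2, h1⟩

theorem Entails.eq_trans {φ : HornFormula Sig x} {s : S} {t t' t'' : Term Sig x s}
    (h : Entails T φ (.eq t t')) (h' : Entails T φ (.eq t' t'')) : Entails T φ (.eq t t'') :=
  fun N m hm => by
    obtain ⟨a, h1, h2⟩ := h N m hm
    obtain ⟨b, h3, h4⟩ := h' N m hm
    exact ⟨a, h1, Part.mem_unique h3 h2 ▸ h4⟩

theorem Entails.var (φ : HornFormula Sig x) (i : Set.Iio x.length) :
    Entails T φ (.eq (.var i) (.var i)) := fun N m _ => by
  simp [HornFormula.holds_eq_self, Term.eval]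

theorem Entails.of_app {φ : HornFormula Sig x} {f : Sig.Fn}
    {τ : ∀ i, Term Sig x ((Sig.fnArity f).sort i)}
    (h : Entails T φ (.eq (.app f τ) (.app f τ))) (i) : Entails T φ (.eq (τ i) (τ i)) :=
  fun N m hm => by
    have := h N m hm
    rw [HornFormula.holds_eq_self, Part.dom_iff_mem] at this ⊢
    obtain ⟨y, hy⟩ := this
    obtain ⟨a, ha, -⟩ := (Term.mem_eval_app ..).1 hy
    exact ⟨_, ha i⟩

/-- Definedness is needed on one side only; the other side then has the same argument values. -/
theorem Entails.app_congr {φ : HornFormula Sig x} {f : Sig.Fn}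
    {τ τ' : ∀ i, Term Sig x ((Sig.fnArity f).sort i)}
    (h : Entails T φ (.eq (.app f τ) (.app f τ))) (h' : ∀ i, Entails T φ (.eq (τ i) (τ' i))) :
    Entails T φ (.eq (.app f τ) (.app f τ')) :=
  fun N m hm => by
    obtain ⟨y, hy, -⟩ := h N m hm
    refine ⟨y, hy, ?_⟩
    rw [Term.mem_eval_app] at hy ⊢
    obtain ⟨a, ha, hy⟩ := hy
    refine ⟨a, fun i => ?_, hy⟩
    obtain ⟨b, h1, h2⟩ := h' i N m hm
    exact Part.mem_unique h1 (ha i) ▸ h2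

/-- Terms whose definedness is entailed by `φ`, up to provable equality. -/
def termSetoid (T : Theory Sig) (φ : HornFormula Sig x) (s : S) :
    Setoid {t : Term Sig x s // Entails T φ (.eq t t)} where
  r t t' := Entails T φ (.eq t.1 t'.1)
  iseqv := ⟨fun t => t.2, fun h => h.eq_symm, fun h h' => h.eq_trans h'⟩

/-- The elements of the model representing `φ`. -/
def RepCarrier (T : Theory Sig) (φ : HornFormula Sig x) (s : S) : Type w :=
  Quotient (termSetoid T φ s)

/-- The class of a term. -/
def RepCarrier.mk {φ : HornFormula Sig x} {s : S} (t : Term Sig x s)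
    (h : Entails T φ (.eq t t)) : RepCarrier T φ s :=
  Quotient.mk _ ⟨t, h⟩

theorem RepCarrier.mk_eq {φ : HornFormula Sig x} {s : S} {t t' : Term Sig x s}
    {h : Entails T φ (.eq t t)} {h' : Entails T φ (.eq t' t')} :
    RepCarrier.mk t h = RepCarrier.mk t' h' ↔ Entails T φ (.eq t t') :=
  Quotient.eq (r := termSetoid T φ s)

theorem RepCarrier.exists_mk {φ : HornFormula Sig x} {s : S} (a : RepCarrier T φ s) :
    ∃ t h, RepCarrier.mk t h = a := by
  induction a using Quotient.inductionOn with
  | h t => exact ⟨t.1, t.2, rfl⟩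

/-- The partial structure representing the formula `φ`. -/
noncomputable def repStr (T : Theory Sig) (φ : HornFormula Sig x) : PStr Sig where
  carrier := RepCarrier T φ
  fn f a := partOf fun b => ∃ t, ∃ ht : ∀ i, Entails T φ (.eq (t i) (t i)), ∃ h, (a = fun i => RepCarrier.mk (t i) (ht i)) ∧
    b = RepCarrier.mk (.app f t) h
  rel R := {a | ∃ t, ∃ ht : ∀ i, Entails T φ (.eq (t i) (t i)), (a = fun i => RepCarrier.mk (t i) (ht i)) ∧ Entails T φ (.rel R t)}

theorem mem_repStr_fn {φ : HornFormula Sig x} {f : Sig.Fn}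
    {a : ∀ i, (repStr T φ).carrier ((Sig.fnArity f).sort i)}
    {b : (repStr T φ).carrier (Sig.fnSort f)} :
    b ∈ (repStr T φ).fn f a ↔ ∃ t, ∃ ht : ∀ i, Entails T φ (.eq (t i) (t i)), ∃ h, (a = fun i => RepCarrier.mk (t i) (ht i)) ∧
      b = RepCarrier.mk (.app f t) h := by
  refine mem_partOf ?_
  rintro _ _ ⟨t, ht, h, rfl, rfl⟩ ⟨t', ht', h', he, rfl⟩
  refine RepCarrier.mk_eq.2 ?_
  exact h.app_congr fun i => RepCarrier.mk_eq.1 (congrFun he i)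

/-- The value of an element of the representing structure at a tuple satisfying `φ`. -/
noncomputable def RepCarrier.value {φ : HornFormula Sig x} {N : PMod T}
    {m : ∀ i, N.obj.carrier (x.sort i)} (hm : φ.Holds N.obj m) {s : S} :
    RepCarrier T φ s → N.obj.carrier s :=
  Quotient.lift (fun t => (t.1.eval N.obj m).get
    ((HornFormula.holds_eq_self _ _ _).1 (t.2 N m hm))) (fun t t' h => by
      obtain ⟨a, h1, h2⟩ := h N m hm
      rw [Part.get_eq_of_mem h1, Part.get_eq_of_mem h2])

theorem RepCarrier.value_mem {φ : HornFormula Sig x} {N : PMod T}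
    {m : ∀ i, N.obj.carrier (x.sort i)} (hm : φ.Holds N.obj m) {s : S} (t : Term Sig x s) (ht) :
    RepCarrier.value hm (.mk t ht) ∈ t.eval N.obj m :=
  Part.get_mem _

/-- The homomorphism from the representing structure induced by a tuple satisfying `φ`. -/
noncomputable def repStrDesc {φ : HornFormula Sig x} {N : PMod T}
    {m : ∀ i, N.obj.carrier (x.sort i)} (hm : φ.Holds N.obj m) : repStr T φ ⟶ N.obj :=
  PStr.Hom.mk (fun _ => RepCarrier.value hm)
    (fun f a b hb => by
      obtain ⟨t, ht, h, rfl, rfl⟩ := mem_repStr_fn.1 hb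
      have := RepCarrier.value_mem hm (.app f t) h
      rw [Term.mem_eval_app] at this
      obtain ⟨c, hc, hv⟩ := this
      convert hv using 1
      congr 1
      exact funext fun i => Part.mem_unique (RepCarrier.value_mem hm _ _) (hc i))
    (fun R a ha => by
      obtain ⟨t, ht, rfl, h⟩ := ha
      have := h N m hm
      rw [HornFormula.holds_rel] at this
      obtain ⟨c, hc, hv⟩ := this
      convert hv using 1
      exact funext fun i => Part.mem_unique (RepCarrier.value_mem hm _ _) (hc i))

/-- Since entailment quantifies over all pairs of a model and a tuple satisfying `φ`, whatever holds
at all these pairs is entailed. The index type is large, which `JointlyReflecting` allows. This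
makes `repStr T φ` a model without any derivation calculus. -/
theorem repStrDesc_reflecting (T : Theory Sig) (φ : HornFormula Sig x) :
    JointlyReflecting fun p : Σ N : PMod T,
      {m : ∀ i, N.obj.carrier (x.sort i) // φ.Holds N.obj m} => repStrDesc p.2.2 where
  inj s a b h := by
    obtain ⟨t, ht, rfl⟩ := RepCarrier.exists_mk a
    obtain ⟨t', ht', rfl⟩ := RepCarrier.exists_mk b
    refine RepCarrier.mk_eq.2 ?_
    intro N m hm
    refine ⟨_, RepCarrier.value_mem hm t ht, ?_⟩
    have : RepCarrier.value hm (.mk t ht) = RepCarrier.value hm (.mk t' ht') := h ⟨N, m, hm⟩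
    rw [this]
    exact RepCarrier.value_mem hm t' ht'
  dom f a h := by
    choose t ht hta using fun i => RepCarrier.exists_mk (a i)
    obtain rfl := funext hta
    refine Part.dom_iff_mem.2 ⟨_, mem_repStr_fn.2 ⟨t, ht, fun N m hm => ?_, rfl, rfl⟩⟩
    rw [HornFormula.holds_eq_self]
    exact Part.dom_iff_mem.2 ⟨_, (Term.mem_eval_app ..).2
      ⟨_, fun i => RepCarrier.value_mem hm (t i) (ht i), Part.get_mem (h ⟨N, m, hm⟩)⟩⟩
  rel R a h := by
    choose t ht hta using fun i => RepCarrier.exists_mk (a i)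
    obtain rfl := funext hta
    exact ⟨t, ht, rfl, fun N m hm => (HornFormula.holds_rel ..).2
      ⟨_, fun i => RepCarrier.value_mem hm (t i) (ht i), h ⟨N, m, hm⟩⟩⟩

/-- The model representing the formula `φ`. -/
noncomputable def rep (T : Theory Sig) (φ : HornFormula Sig x) : PMod T :=
  ⟨repStr T φ, (repStrDesc_reflecting T φ).isModel fun p => p.1.property⟩

/-- The generic tuple satisfying `φ`. -/
def rep.gen (T : Theory Sig) (φ : HornFormula Sig x) (i : Set.Iio x.length) :
    (rep T φ).obj.carrier (x.sort i) :=
  RepCarrier.mk (.var i) (Entails.var φ i)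

/-- The morphism induced by a tuple satisfying `φ`. -/
noncomputable def rep.desc {φ : HornFormula Sig x} {N : PMod T}
    (m : ∀ i, N.obj.carrier (x.sort i)) (hm : φ.Holds N.obj m) : rep T φ ⟶ N :=
  ObjectProperty.homMk (repStrDesc hm)

theorem rep.desc_gen {φ : HornFormula Sig x} {N : PMod T}
    (m : ∀ i, N.obj.carrier (x.sort i)) (hm : φ.Holds N.obj m) (i) :
    (rep.desc m hm).hom.toFun _ (rep.gen T φ i) = m i :=
  (Term.mem_eval_var ..).1 (RepCarrier.value_mem hm (.var i) (Entails.var φ i))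

/-- The jointly reflecting family sends the generic tuple to tuples that satisfy `φ` by choice. -/
theorem rep.holds_gen (T : Theory Sig) (φ : HornFormula Sig x) :
    φ.Holds (rep T φ).obj (rep.gen T φ) := by
  refine (repStrDesc_reflecting T φ).holds _ _ fun p => ?_
  convert p.2.2 with i
  exact rep.desc_gen p.2.1 p.2.2 i

/-- This is why the generic tuple generates the model, hence why maps out of it are determined by
that tuple. -/
theorem rep.mem_eval_gen {φ : HornFormula Sig x} {s : S} (t : Term Sig x s)
    (ht : Entails T φ (.eq t t)) :
    RepCarrier.mk t ht ∈ t.eval (rep T φ).obj (rep.gen T φ) := by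
  induction t with
  | var i => exact (Term.mem_eval_var ..).2 rfl
  | app f τ ih =>
    exact (Term.mem_eval_app ..).2
      ⟨_, fun i => ih i (ht.of_app i), mem_repStr_fn.2 ⟨τ, ht.of_app, ht, rfl, rfl⟩⟩

theorem rep.exists_eval {φ : HornFormula Sig x} {s : S} (a : (rep T φ).obj.carrier s) :
    ∃ t : Term Sig x s, a ∈ t.eval (rep T φ).obj (rep.gen T φ) := by
  obtain ⟨t, ht, rfl⟩ := RepCarrier.exists_mk a
  exact ⟨t, rep.mem_eval_gen t ht⟩

theorem rep.hom_ext {φ : HornFormula Sig x} {N : PMod T} {g h : rep T φ ⟶ N}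
    (H : ∀ i, g.hom.toFun _ (rep.gen T φ i) = h.hom.toFun _ (rep.gen T φ i)) : g = h := by
  refine PMod.hom_ext fun s a => ?_
  obtain ⟨t, ht⟩ := rep.exists_eval a
  have h1 := PStr.Hom.map_eval g.hom _ _ _ ht
  rw [funext H] at h1
  exact Part.mem_unique h1 (PStr.Hom.map_eval h.hom _ _ _ ht)

theorem rep.mem_of_closed {φ : HornFormula Sig x} {P : ∀ s, Set ((rep T φ).obj.carrier s)}
    (hP : FnClosed (rep T φ).obj P) (h : ∀ i, rep.gen T φ i ∈ P _) {s : S}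
    (a : (rep T φ).obj.carrier s) : a ∈ P s := by
  obtain ⟨t, ht⟩ := rep.exists_eval a
  exact hP.eval_mem _ h t a ht

theorem rep.holds_map {φ : HornFormula Sig x} {N : PMod T} (g : rep T φ ⟶ N) :
    φ.Holds N.obj fun i => g.hom.toFun _ (rep.gen T φ i) :=
  PStr.Hom.map_holds g.hom _ _ (rep.holds_gen T φ)

/-! ### Colimits of `κ`-filtered diagrams -/

theorem hasCardinalLT_Iio (α : κ.ord.ToType) : HasCardinalLT (Set.Iio α) κ := by
  rw [hasCardinalLT_iff_cardinal_mk_lt]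
  simpa using Cardinal.mk_Iio_lt α

section Colimit

variable {J : Type w} [SmallCategory J] (D : J ⥤ PStr Sig) (K : J ⥤ PMod T)

/-- The identification of elements of the stages of a filtered diagram. -/
def ColimRel (s : S) (p q : Σ j, (D.obj j).carrier s) : Prop :=
  ∃ (k : J) (a : p.1 ⟶ k) (b : q.1 ⟶ k), (D.map a).toFun s p.2 = (D.map b).toFun s q.2

theorem map_comp_toFun {i j k : J} (a : i ⟶ j) (b : j ⟶ k) {s : S} (y : (D.obj i).carrier s) :
    (D.map (a ≫ b)).toFun s y = (D.map b).toFun s ((D.map a).toFun s y) := by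
  rw [D.map_comp]
  rfl

theorem map_id_toFun (i : J) {s : S} (y : (D.obj i).carrier s) :
    (D.map (𝟙 i)).toFun s y = y := by
  rw [D.map_id]
  rfl

theorem cocone_map_toFun (c : Cocone K) {j k : J} (u : j ⟶ k) {s : S}
    (a : (K.obj j).obj.carrier s) :
    (c.ι.app k).hom.toFun s ((K.map u).hom.toFun s a) = (c.ι.app j).hom.toFun s a := by
  rw [← c.w u]
  rfl

variable [Fact κ.IsRegular] [IsCardinalFiltered J κ]

theorem colimRel_equivalence (s : S) : Equivalence (ColimRel D s) where
  refl p := ⟨p.1, 𝟙 _, 𝟙 _, rfl⟩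
  symm := fun ⟨k, a, b, h⟩ => ⟨k, b, a, h.symm⟩
  trans := by
    rintro ⟨i, x⟩ ⟨j, y⟩ ⟨l, z⟩ ⟨k, a, b, h⟩ ⟨k', a', b', h'⟩
    have := isFiltered_of_isCardinalFiltered J κ
    obtain ⟨n, c, c', hc⟩ := IsFiltered.span b a'
    refine ⟨n, a ≫ c, b' ≫ c', ?_⟩
    rw [map_comp_toFun, map_comp_toFun, h, ← h', ← map_comp_toFun, ← map_comp_toFun, hc]

/-- The carriers of the colimit. -/
def ColimCarrier (s : S) : Type w :=
  Quotient ⟨ColimRel D s, colimRel_equivalence D s⟩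

/-- The map from a stage to the colimit. -/
def colimMk (j : J) {s : S} (a : (D.obj j).carrier s) : ColimCarrier D s :=
  Quotient.mk _ ⟨j, a⟩

theorem colimMk_eq {j k : J} {s : S} {a : (D.obj j).carrier s} {b : (D.obj k).carrier s} :
    colimMk D j a = colimMk D k b ↔ ColimRel D s ⟨j, a⟩ ⟨k, b⟩ :=
  Quotient.eq (r := ⟨ColimRel D s, colimRel_equivalence D s⟩)

theorem colimMk_map {j k : J} (u : j ⟶ k) {s : S} (a : (D.obj j).carrier s) :
    colimMk D k ((D.map u).toFun s a) = colimMk D j a :=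
  (colimMk_eq D).2 ⟨k, 𝟙 k, u, map_id_toFun D k _⟩

theorem exists_colimMk {s : S} (a : ColimCarrier D s) : ∃ j b, colimMk D j b = a := by
  induction a using Quotient.inductionOn with
  | h t => exact ⟨t.1, t.2, rfl⟩

theorem exists_colimMk_family {I : Type w} (hI : HasCardinalLT I κ) (σ : I → S)
    (a : ∀ i, ColimCarrier D (σ i)) :
    ∃ (j : J) (b : ∀ i, (D.obj j).carrier (σ i)), ∀ i, colimMk D j (b i) = a i := by
  choose j b hb using fun i => exists_colimMk D (a i)
  exact ⟨IsCardinalFiltered.max j hI,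
    fun i => (D.map (IsCardinalFiltered.toMax j hI i)).toFun _ (b i), fun i => by
      rw [colimMk_map, hb]⟩

theorem exists_map_eq_family {I : Type w} (hI : HasCardinalLT I κ) (σ : I → S) {j j' : J}
    (a : ∀ i, (D.obj j).carrier (σ i)) (a' : ∀ i, (D.obj j').carrier (σ i))
    (h : ∀ i, colimMk D j (a i) = colimMk D j' (a' i)) :
    ∃ (k : J) (u : j ⟶ k) (v : j' ⟶ k),
      ∀ i, (D.map u).toFun _ (a i) = (D.map v).toFun _ (a' i) := by
  have := isFiltered_of_isCardinalFiltered J κ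
  have H : ∀ i, ∃ (k : J) (w : IsFiltered.max j j' ⟶ k),
      (D.map (IsFiltered.leftToMax j j' ≫ w)).toFun _ (a i) =
        (D.map (IsFiltered.rightToMax j j' ≫ w)).toFun _ (a' i) := by
    intro i
    obtain ⟨l, u, v, huv⟩ := (colimMk_eq D).1 (h i)
    obtain ⟨k, p, q, h1, h2⟩ := IsFiltered.bowtie (IsFiltered.leftToMax j j') u
      (IsFiltered.rightToMax j j') v
    refine ⟨k, p, ?_⟩
    rw [h1, h2, map_comp_toFun, map_comp_toFun]
    exact congrArg _ huv
  choose k w hw using H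
  -- Each equality holds at its own stage; fewer than `κ` parallel refinements are merged into one.
  obtain ⟨n, b, c, hc⟩ := IsCardinalFiltered.wideSpan w hI
  refine ⟨n, IsFiltered.leftToMax j j' ≫ c, IsFiltered.rightToMax j j' ≫ c, fun i => ?_⟩
  rw [← hc i, ← Category.assoc, ← Category.assoc, map_comp_toFun, hw, ← map_comp_toFun]

/-- The colimit of a `κ`-filtered diagram of partial structures. -/
noncomputable def colimStr : PStr Sig where
  carrier := ColimCarrier D
  fn f a := partOf fun c => ∃ (j : J) (b : ∀ i, (D.obj j).carrier ((Sig.fnArity f).sort i)),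
    ∃ d ∈ (D.obj j).fn f b, (a = fun i => colimMk D j (b i)) ∧ c = colimMk D j d
  rel R := {a | ∃ (j : J) (b : ∀ i, (D.obj j).carrier ((Sig.relArity R).sort i)),
    b ∈ (D.obj j).rel R ∧ a = fun i => colimMk D j (b i)}

/-- Single-valuedness: two representatives of an argument tuple, having fewer than `κ` entries,
already agree at a common stage. -/
theorem mem_colimStr_fn {f : Sig.Fn} {a : ∀ i, (colimStr D).carrier ((Sig.fnArity f).sort i)}
    {c : (colimStr D).carrier (Sig.fnSort f)} :
    c ∈ (colimStr D).fn f a ↔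
      ∃ (j : J) (b : ∀ i, (D.obj j).carrier ((Sig.fnArity f).sort i)),
        ∃ d ∈ (D.obj j).fn f b, (a = fun i => colimMk D j (b i)) ∧ c = colimMk D j d := by
  refine mem_partOf ?_
  rintro _ _ ⟨j, b, d, hd, rfl, rfl⟩ ⟨j', b', d', hd', he, rfl⟩
  obtain ⟨k, u, v, huv⟩ := exists_map_eq_family D (hasCardinalLT_Iio _) _ b b' (congrFun he)
  have h1 := (D.map u).map_fn f b d hd
  rw [funext huv] at h1
  exact (colimMk_eq D).2 ⟨k, u, v, Part.mem_unique h1 ((D.map v).map_fn f b' d' hd')⟩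

/-- The homomorphism from a stage to the colimit. -/
noncomputable def colimStrι (j : J) : D.obj j ⟶ colimStr D :=
  PStr.Hom.mk (fun _ a => colimMk D j a)
    (fun _ a b hb => (mem_colimStr_fn D).2 ⟨j, a, b, hb, rfl, rfl⟩)
    (fun _ a ha => ⟨j, a, ha, rfl⟩)

/-- The step shared by `app` and `rel`: the argument values are found at various stages, whereas the
symbol is known to apply to representatives `d` at an unrelated stage `l`. A later stage reconciles
both. -/
theorem exists_stage_eval_family {j : J} (m : ∀ i, (D.obj j).carrier (x.sort i))
    {y : SortFamily κ S} (τ : ∀ i, Term Sig x (y.sort i))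
    (c : ∀ i, (colimStr D).carrier (y.sort i))
    (hc : ∀ i, ∃ (k : J) (u : j ⟶ k),
      ∃ b ∈ (τ i).eval (D.obj k) fun i => (D.map u).toFun _ (m i), colimMk D k b = c i)
    {l : J} (d : ∀ i, (D.obj l).carrier (y.sort i)) (hd : ∀ i, c i = colimMk D l (d i)) :
    ∃ (k : J) (u : j ⟶ k) (v : l ⟶ k),
      ∀ i, (D.map v).toFun _ (d i) ∈ (τ i).eval (D.obj k) fun i => (D.map u).toFun _ (m i) := by
  choose k u b hb hbc using hc
  obtain ⟨n, p, q, hpq⟩ := IsCardinalFiltered.wideSpan u (hasCardinalLT_Iio _)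
  have hb' : ∀ i, (D.map (p i)).toFun _ (b i) ∈
      (τ i).eval (D.obj n) fun i => (D.map q).toFun _ (m i) := by
    intro i
    have := PStr.Hom.map_eval (D.map (p i)) _ _ _ (hb i)
    simpa only [← map_comp_toFun, hpq] using this
  obtain ⟨r, e, v, hev⟩ := exists_map_eq_family D (hasCardinalLT_Iio _) _
    (fun i => (D.map (p i)).toFun _ (b i)) d (fun i => by rw [colimMk_map, hbc, hd])
  refine ⟨r, q ≫ e, v, fun i => ?_⟩
  rw [← hev]
  have := PStr.Hom.map_eval (D.map e) _ _ _ (hb' i)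
  simpa only [← map_comp_toFun] using this

theorem exists_stage_eval {j : J} (m : ∀ i, (D.obj j).carrier (x.sort i)) {s : S}
    (τ : Term Sig x s) (c : (colimStr D).carrier s)
    (hc : c ∈ τ.eval (colimStr D) fun i => colimMk D j (m i)) :
    ∃ (k : J) (u : j ⟶ k), ∃ b ∈ τ.eval (D.obj k) fun i => (D.map u).toFun _ (m i),
      colimMk D k b = c := by
  induction τ with
  | var i =>
    exact ⟨j, 𝟙 j, _, (Term.mem_eval_var ..).2 rfl,
      (colimMk_map D _ _).trans ((Term.mem_eval_var ..).1 hc).symm⟩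
  | app f τ ih =>
    obtain ⟨a, ha, hc⟩ := (Term.mem_eval_app ..).1 hc
    obtain ⟨l, d, e, he, had, rfl⟩ := (mem_colimStr_fn D).1 hc
    obtain ⟨k, u, v, huv⟩ := exists_stage_eval_family D m τ a (fun i => ih i _ (ha i)) d
      (congrFun had)
    exact ⟨k, u, _, (Term.mem_eval_app ..).2 ⟨_, huv, (D.map v).map_fn f d e he⟩,
      colimMk_map D v e⟩

theorem exists_stage_holds {j : J} (m : ∀ i, (D.obj j).carrier (x.sort i))
    (φ : HornFormula Sig x) (hφ : φ.Holds (colimStr D) fun i => colimMk D j (m i)) :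
    ∃ (k : J) (u : j ⟶ k), φ.Holds (D.obj k) fun i => (D.map u).toFun _ (m i) := by
  induction φ with
  | rel R τ =>
    obtain ⟨a, ha, l, d, hd, had⟩ := (HornFormula.holds_rel ..).1 hφ
    obtain ⟨k, u, v, huv⟩ := exists_stage_eval_family D m τ a
      (fun i => exists_stage_eval D m _ _ (ha i)) d (congrFun had)
    exact ⟨k, u, (HornFormula.holds_rel ..).2 ⟨_, huv, (D.map v).map_rel R d hd⟩⟩
  | eq τ τ' =>
    obtain ⟨a, h, h'⟩ := hφ
    obtain ⟨k, u, b, hb, hba⟩ := exists_stage_eval D m _ _ h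
    obtain ⟨k', u', b', hb', hba'⟩ := exists_stage_eval D m _ _ h'
    obtain ⟨l, v, v', hv⟩ := (colimMk_eq D).1 (hba.trans hba'.symm)
    have := isFiltered_of_isCardinalFiltered J κ
    -- The two paths out of `j` must be equalized so that both terms are evaluated at the same
    -- tuple.
    let e := IsFiltered.coeqHom (u ≫ v) (u' ≫ v')
    have he : (u ≫ v) ≫ e = (u' ≫ v') ≫ e := IsFiltered.coeq_condition _ _
    have h1 := PStr.Hom.map_eval (D.map (v ≫ e)) _ _ _ hb
    have h2 := PStr.Hom.map_eval (D.map (v' ≫ e)) _ _ _ hb'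
    refine ⟨_, (u ≫ v) ≫ e, (D.map (v ≫ e)).toFun _ b, ?_, ?_⟩
    · simpa only [← map_comp_toFun, Category.assoc] using h1
    · rw [he, map_comp_toFun D v e, hv, ← map_comp_toFun]
      simpa only [← map_comp_toFun, Category.assoc] using h2
  | top => exact ⟨j, 𝟙 j, trivial⟩
  | conj α φ ih =>
    choose k u h using fun i => ih i (hφ i)
    obtain ⟨n, p, q, hpq⟩ := IsCardinalFiltered.wideSpan u (hasCardinalLT_Iio α)
    refine ⟨n, q, fun i => ?_⟩
    have := PStr.Hom.map_holds (D.map (p i)) _ _ (h i)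
    simpa only [← map_comp_toFun, hpq] using this

theorem exists_stage_holds_of_holds (m : ∀ i, (colimStr D).carrier (x.sort i))
    (φ : HornFormula Sig x) (hφ : φ.Holds (colimStr D) m) :
    ∃ (k : J) (m' : ∀ i, (D.obj k).carrier (x.sort i)), φ.Holds (D.obj k) m' ∧
      ∀ i, colimMk D k (m' i) = m i := by
  obtain ⟨j, b, hb⟩ := exists_colimMk_family D (hasCardinalLT_Iio x.length) _ m
  obtain rfl := funext hb
  obtain ⟨k, u, h⟩ := exists_stage_holds D b φ hφ
  exact ⟨k, _, h, fun i => colimMk_map D u _⟩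

theorem isModel_colimStr (hD : ∀ j, isModel T (D.obj j)) : isModel T (colimStr D) := by
  intro σ hσ m hm
  obtain ⟨k, m', h, hm'⟩ := exists_stage_holds_of_holds D m _ hm
  obtain rfl := funext hm'
  exact PStr.Hom.map_holds (colimStrι D k) _ _ (hD k σ hσ m' h)

/-- The colimit of a `κ`-filtered diagram of models. -/
noncomputable def colimMod : PMod T :=
  ⟨colimStr (K ⋙ (isModel T).ι), isModel_colimStr _ fun j => (K.obj j).property⟩

/-- The colimit cocone of a `κ`-filtered diagram of models. -/
noncomputable def colimCocone : Cocone K where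
  pt := colimMod K
  ι :=
    { app := fun j => ObjectProperty.homMk (colimStrι (K ⋙ (isModel T).ι) j)
      naturality := fun _ _ u => PMod.hom_ext fun _ a => colimMk_map (K ⋙ (isModel T).ι) u a }

/-- The map out of the carriers of the colimit induced by a cocone. -/
def colimDesc (c : Cocone K) (s : S) :
    ColimCarrier (K ⋙ (isModel T).ι) s → c.pt.obj.carrier s :=
  Quotient.lift (fun p => (c.ι.app p.1).hom.toFun s p.2) (by
    rintro ⟨j, a⟩ ⟨k, b⟩ ⟨l, u, v, h⟩
    refine (cocone_map_toFun K c u a).symm.trans (Eq.trans ?_ (cocone_map_toFun K c v b))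
    exact congrArg _ h)

/-- The universal property of the colimit of a `κ`-filtered diagram of models. -/
noncomputable def colimCoconeIsColimit : IsColimit (colimCocone K) where
  desc c := ObjectProperty.homMk (PStr.Hom.mk (colimDesc K c)
    (fun f a b hb => by
      obtain ⟨j, d, e, he, rfl, rfl⟩ := (mem_colimStr_fn _).1 hb
      exact (c.ι.app j).hom.map_fn f d e he)
    (fun R a ha => by
      obtain ⟨j, d, hd, rfl⟩ := ha
      exact (c.ι.app j).hom.map_rel R d hd))
  fac c j := rfl
  uniq c g hg := PMod.hom_ext fun s a => by
    obtain ⟨j, b, rfl⟩ := exists_colimMk _ a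
    have := hg j
    exact congrArg (fun h => h.hom.toFun s b) this

end Colimit

theorem isCardinalPresentable_rep [Fact κ.IsRegular] (T : Theory Sig) (φ : HornFormula Sig x) :
    IsCardinalPresentable (rep T φ) κ where
  preservesColimitOfShape J _ _ := ⟨fun {K} =>
    preservesColimit_of_preserves_colimit_cocone (colimCoconeIsColimit K) (by
      -- A map out of `rep T φ` amounts to a tuple satisfying `φ`: such tuples lift to a stage, and
      -- two lifts with the same image agree at a later one.
      refine Types.FilteredColimit.isColimitOf _ _ ?_ ?_
      · intro (g : rep T φ ⟶ colimMod K)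
        obtain ⟨k, m, hm, h⟩ := exists_stage_holds_of_holds _ _ φ (rep.holds_map g)
        exact ⟨k, (rep.desc m hm : rep T φ ⟶ K.obj k), rep.hom_ext fun i =>
          (h i).symm.trans (congrArg _ (rep.desc_gen m hm i).symm)⟩
      · intro j k (g : rep T φ ⟶ K.obj j) (h : rep T φ ⟶ K.obj k)
          (e : g ≫ (colimCocone K).ι.app j = h ≫ (colimCocone K).ι.app k)
        obtain ⟨l, u, v, huv⟩ := exists_map_eq_family (K ⋙ (isModel T).ι)
          (hasCardinalLT_Iio x.length) _
          (fun i => g.hom.toFun _ (rep.gen T φ i)) (fun i => h.hom.toFun _ (rep.gen T φ i))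
          (fun i => congrArg (fun p => p.hom.toFun _ (rep.gen T φ i)) e)
        exact ⟨l, u, v, (rep.hom_ext huv : g ≫ K.map u = h ≫ K.map v)⟩)⟩

/-! ### Closed monomorphisms and dense morphisms -/

/-- Provides a context length with two distinct variable positions below it. -/
theorem exists_lt_lt_toType (κ : Cardinal.{w}) [Fact κ.IsRegular] :
    ∃ i j k : κ.ord.ToType, i < j ∧ j < k := by
  have hκ : κ.IsRegular := Fact.out
  have := Cardinal.noMaxOrder hκ.aleph0_le
  have : Nonempty κ.ord.ToType := by
    rw [← Cardinal.mk_ne_zero_iff]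
    simpa using hκ.pos.ne'
  obtain ⟨i⟩ := this
  obtain ⟨j, hij⟩ := exists_gt i
  obtain ⟨k, hjk⟩ := exists_gt j
  exact ⟨i, j, k, hij, hjk⟩

theorem injective_of_mono [Fact κ.IsRegular] {A B : PMod T} (h : A ⟶ B) [Mono h] (s : S) :
    Function.Injective (h.hom.toFun s) := by
  intro a b hab
  obtain ⟨i, j, α, hij, hα⟩ := exists_lt_lt_toType κ
  -- Constant tuples in this context stand in for single elements, and the position `j'` recovers
  -- the element.
  let x : SortFamily κ S := ⟨α, fun _ => s⟩
  let j' : Set.Iio x.length := ⟨j, hα⟩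
  let g (c : A.obj.carrier s) : rep T (.top : HornFormula Sig x) ⟶ A :=
    rep.desc (fun _ => c) trivial
  have hg : ∀ c, (g c).hom.toFun _ (rep.gen T _ j') = c := fun c => rep.desc_gen (x := x) _ _ j'
  have : g a = g b := by
    rw [← cancel_mono h]
    refine rep.hom_ext fun j => ?_
    have h1 := rep.desc_gen (T := T) (φ := (.top : HornFormula Sig x)) (fun _ => a) trivial j
    have h2 := rep.desc_gen (T := T) (φ := (.top : HornFormula Sig x)) (fun _ => b) trivial j
    exact (congrArg _ h1).trans (hab.trans (congrArg _ h2).symm)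
  rw [← hg a, this, hg b]

theorem closedMono_of_reflecting {A B : PMod T} (h : A ⟶ B)
    (H : JointlyReflecting fun _ : Unit => h.hom) : closedMono T h := by
  refine ⟨⟨fun g g' e => PMod.hom_ext fun s a => H.inj _ _ _ fun _ => ?_⟩, fun f => ?_,
    fun R => ?_⟩
  · exact congrArg (fun p => p.hom.toFun s a) e
  · ext a
    exact ⟨fun ha => (h.hom.map_fn f a _ (Part.get_mem ha)).1, fun ha => H.dom f a fun _ => ha⟩
  · ext a
    exact ⟨fun ha => h.hom.map_rel R a ha, fun ha => H.rel R a fun _ => ha⟩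

theorem closedMono_iff [Fact κ.IsRegular] {A B : PMod T} (h : A ⟶ B) :
    closedMono T h ↔ JointlyReflecting fun _ : Unit => h.hom := by
  refine ⟨fun ⟨_, hf, hR⟩ => ⟨fun s a b e => injective_of_mono h s (e ()), fun f a ha => ?_,
    fun R a ha => ?_⟩, closedMono_of_reflecting h⟩
  · exact (Set.ext_iff.1 (hf f) a).2 (ha ())
  · exact (Set.ext_iff.1 (hR R) a).2 (ha ())

theorem closedMono_subι (M : PMod T) (P : ∀ s, Set (M.obj.carrier s)) (hP : FnClosed M.obj P) :
    closedMono T (M.subι P hP) :=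
  closedMono_of_reflecting _ (M.obj.subι_reflecting P hP)

theorem surjective_of_isIso {A B : PMod T} (h : A ⟶ B) [IsIso h] (s : S) :
    Function.Surjective (h.hom.toFun s) := fun b =>
  ⟨(inv h).hom.toFun s b, congrArg (fun p => p.hom.toFun s b) (IsIso.inv_hom_id h)⟩

/-- A morphism is dense iff its image generates the codomain. -/
theorem dense_iff [Fact κ.IsRegular] {A B : PMod T} (h : A ⟶ B) :
    dense T h ↔ ∀ P : ∀ s, Set (B.obj.carrier s), FnClosed B.obj P →
      (∀ s a, h.hom.toFun s a ∈ P s) → ∀ s b, b ∈ P s := by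
  constructor
  · intro hh P hP hA s b
    have := hh (PMod.subLift P hP h hA) _ (closedMono_subι B P hP) rfl
    obtain ⟨a, rfl⟩ := surjective_of_isIso (B.subι P hP) s b
    exact a.2
  · intro H C g m hm e
    rw [closedMono_iff] at hm
    refine isIso_of_bijective m hm fun s b => ?_
    -- The range of `m` is closed because `m` reflects definedness, and it contains the image of
    -- `h`.
    refine H _ (FnClosed.range m.hom fun f a ha => hm.dom f a fun _ => ha) (fun s a => ?_) s b
    rw [← e]
    exact ⟨g.hom.toFun s a, rfl⟩

theorem dense_comp [Fact κ.IsRegular] {A B C : PMod T} (g : A ⟶ B) (h : B ⟶ C)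
    (hg : dense T g) (hh : dense T h) : dense T (g ≫ h) := by
  rw [dense_iff] at *
  intro P hP H
  exact hh P hP fun s b => hg _ (hP.preimage h.hom) H s b

theorem closedMono_comp [Fact κ.IsRegular] {A B C : PMod T} (g : A ⟶ B) (h : B ⟶ C)
    (hg : closedMono T g) (hh : closedMono T h) : closedMono T (g ≫ h) := by
  rw [closedMono_iff] at *
  exact ⟨fun s a b e => hg.inj _ _ _ fun _ => hh.inj _ _ _ e,
    fun f a ha => hg.dom f a fun _ => hh.dom f _ ha,
    fun R a ha => hg.rel R a fun _ => hh.rel R _ ha⟩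

theorem dense_of_isIso [Fact κ.IsRegular] {A B : PMod T} (h : A ⟶ B) [IsIso h] :
    dense T h := by
  rw [dense_iff]
  intro P _ H s b
  obtain ⟨a, rfl⟩ := surjective_of_isIso h s b
  exact H s a

theorem closedMono_of_isIso {A B : PMod T} (h : A ⟶ B) [IsIso h] : closedMono T h := by
  have hi : ∀ s a, (inv h).hom.toFun s (h.hom.toFun s a) = a := fun s a =>
    congrArg (fun p => p.hom.toFun s a) (IsIso.hom_inv_id h)
  refine closedMono_of_reflecting _ ⟨fun s a b e => ?_, fun f a ha => ?_, fun R a ha => ?_⟩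
  · rw [← hi s a, e (), hi]
  · have := (inv h).hom.map_fn f _ _ (Part.get_mem (ha ()))
    simp only [hi] at this
    exact this.1
  · have := (inv h).hom.map_rel R _ (ha ())
    simpa only [hi] using this

theorem exists_dense_closedMono [Fact κ.IsRegular] {A B : PMod T} (h : A ⟶ B) :
    ∃ (C : PMod T) (e : A ⟶ C) (m : C ⟶ B), dense T e ∧ closedMono T m ∧ e ≫ m = h := by
  let P : ∀ s, Set (B.obj.carrier s) := Generated B.obj fun s => Set.range (h.hom.toFun s)
  have hP : FnClosed B.obj P := Generated.fn
  refine ⟨B.sub P hP, PMod.subLift P hP h fun s a => .base _ ⟨a, rfl⟩, B.subι P hP, ?_,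
    closedMono_subι B P hP, rfl⟩
  rw [dense_iff]
  -- A closed subset of the generated submodel containing the image is everything, by induction on
  -- generation.
  rintro Q hQ H s ⟨b, hb⟩
  induction hb with
  | base a ha =>
    obtain ⟨c, rfl⟩ := ha
    exact H _ c
  | fn f a b ha hb ih => exact hQ f (fun i => ⟨a i, ha i⟩) _ ih ⟨hb.1, Subtype.ext hb.2⟩

/-- The elements of `Y` that `b` sends into the range of `m` form a closed subset containing the
image of `e`, hence all of `Y`. Reflection by `m` makes the chosen lifts a homomorphism. -/
theorem orthogonal_dense_closedMono [Fact κ.IsRegular] {X Y A B : PMod T} (e : X ⟶ Y)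
    (m : A ⟶ B) (he : dense T e) (hm : closedMono T m) : Orthogonal e m := by
  intro a b hab
  have : Mono m := hm.1
  rw [closedMono_iff] at hm
  rw [dense_iff] at he
  have H : ∀ s y, ∃ z, m.hom.toFun s z = b.hom.toFun s y := fun s y =>
    he _ ((FnClosed.range m.hom fun f a ha => hm.dom f a fun _ => ha).preimage b.hom)
      (fun s x => ⟨a.hom.toFun s x, congrArg (fun p => p.hom.toFun s x) hab.symm⟩) s y
  choose d hd using H
  let d' : Y ⟶ A := ObjectProperty.homMk (PStr.Hom.mk d
    (fun f y z hz => by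
      have hy := b.hom.map_fn f y z hz
      rw [← funext fun i => hd _ (y i)] at hy
      have hA : (A.obj.fn f fun i => d _ (y i)).Dom := hm.dom f _ fun _ => hy.1
      have : d _ z = (A.obj.fn f fun i => d _ (y i)).get hA := hm.inj _ _ _ fun _ =>
        (hd _ z).trans (Part.mem_unique hy (m.hom.map_fn f _ _ (Part.get_mem hA)))
      rw [this]
      exact Part.get_mem hA)
    (fun R y hy => hm.rel R _ fun _ => by
      have := b.hom.map_rel R y hy
      rwa [← funext fun i => hd _ (y i)] at this))
  have hd' : d' ≫ m = b := PMod.hom_ext hd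
  refine ⟨d', ⟨?_, hd'⟩, fun k hk => ?_⟩
  · rw [← cancel_mono m, Category.assoc, hd', hab]
  · rw [← cancel_mono m, hk.2, hd']

theorem epi_of_dense [Fact κ.IsRegular] {A B : PMod T} (e : A ⟶ B) (he : dense T e) : Epi e where
  left_cancellation {C} g h H := PMod.hom_ext ((dense_iff e).1 he _ (FnClosed.equalizer g.hom h.hom)
    fun s a => congrArg (fun p : A ⟶ C => p.hom.toFun s a) H)

/-! ### Orthogonality to dense morphisms between presentable objects -/

/-- The dense morphism along which a tuple is required to satisfy `φ`. -/
noncomputable def repRestrict (T : Theory Sig) (φ : HornFormula Sig x) :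
    rep T (.top : HornFormula Sig x) ⟶ rep T φ :=
  rep.desc (rep.gen T φ) trivial

theorem presentablePart_repRestrict [Fact κ.IsRegular] (T : Theory Sig) (φ : HornFormula Sig x) :
    presentablePart κ (dense T) (repRestrict T φ) := by
  refine ⟨?_, isCardinalPresentable_rep T _, isCardinalPresentable_rep T _⟩
  rw [dense_iff]
  intro P hP H s b
  refine rep.mem_of_closed hP (fun i => ?_) b
  rw [← rep.desc_gen (φ := .top) (rep.gen T φ) trivial i]
  exact H _ _

/-- The tuple `a` and its image, which satisfies `φ`, form a square from `repRestrict T φ` to `m`. A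
diagonal sends the generic tuple of `rep T φ` to `a`, so `φ` holds at `a`. -/
theorem holds_of_rightOrthogonal [Fact κ.IsRegular] {A B : PMod T} (m : A ⟶ B)
    (hm : rightOrthogonal (presentablePart κ (dense T)) m) (φ : HornFormula Sig x)
    (a : ∀ i, A.obj.carrier (x.sort i)) (h : φ.Holds B.obj fun i => m.hom.toFun _ (a i)) :
    φ.Holds A.obj a := by
  obtain ⟨d, ⟨hd, -⟩, -⟩ := hm _ (presentablePart_repRestrict T φ)
    (rep.desc a trivial) (rep.desc _ h) (rep.hom_ext fun i => by
      have h1 := rep.desc_gen (φ := .top) (rep.gen T φ) trivial i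
      have h2 := rep.desc_gen (T := T) (φ := .top) a trivial i
      exact (congrArg _ h1).trans ((rep.desc_gen _ h i).trans (congrArg _ h2.symm)))
  have := rep.holds_map d
  convert this with i
  rw [← rep.desc_gen (T := T) (φ := .top) a trivial i, ← hd]
  exact congrArg (d.hom.toFun _) (rep.desc_gen (φ := .top) (rep.gen T φ) trivial i)

theorem closedMono_of_rightOrthogonal [Fact κ.IsRegular] {A B : PMod T} (m : A ⟶ B)
    (hm : rightOrthogonal (presentablePart κ (dense T)) m) : closedMono T m := by
  refine closedMono_of_reflecting m ⟨fun s a b e => ?_, fun f a ha => ?_, fun R a ha => ?_⟩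
  · obtain ⟨i, j, α, hij, hα⟩ := exists_lt_lt_toType κ
    classical
    let x : SortFamily κ S := ⟨α, fun _ => s⟩
    let i' : Set.Iio x.length := ⟨i, hij.trans hα⟩
    let j' : Set.Iio x.length := ⟨j, hα⟩
    have hne : j' ≠ i' := fun h => hij.ne' (congrArg Subtype.val h)
    -- Only the positions `i'` and `j'` matter; the remaining ones are filled with `b`.
    let c : ∀ k, A.obj.carrier (x.sort k) := fun k => if k = i' then a else b
    have hci : c i' = a := if_pos rfl
    have hcj : c j' = b := if_neg hne
    have := holds_of_rightOrthogonal m hm (x := x)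
      (.eq (Term.var i' : Term Sig x s) (Term.var j' : Term Sig x s)) c
      ⟨m.hom.toFun s a, (Term.mem_eval_var (x := x) _ _ i' _).2
        (congrArg (m.hom.toFun s) hci.symm), (Term.mem_eval_var (x := x) _ _ j' _).2
        ((e ()).trans (congrArg (m.hom.toFun s) hcj.symm))⟩
    obtain ⟨d, h1, h2⟩ := this
    rw [← hci, ← hcj, ← (Term.mem_eval_var (x := x) _ _ i' _).1 h1]
    exact (Term.mem_eval_var (x := x) _ _ j' _).1 h2
  -- The arity of `f` serves as the context, and definedness is the equation of `f(x)` with itself.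
  · have := holds_of_rightOrthogonal m hm (x := Sig.fnArity f)
      (.eq (.app f .var) (.app f .var)) a ((HornFormula.holds_eq_self ..).2
        (Part.dom_iff_mem.2 ⟨_, (Term.mem_eval_app ..).2
          ⟨_, fun j => (Term.mem_eval_var ..).2 rfl, Part.get_mem (ha ())⟩⟩))
    obtain ⟨y, hy, -⟩ := this
    obtain ⟨b, hb, hyb⟩ := (Term.mem_eval_app ..).1 hy
    obtain rfl : b = a := funext fun j => (Term.mem_eval_var ..).1 (hb j)
    exact hyb.1
  · have := holds_of_rightOrthogonal m hm (x := Sig.relArity R) (.rel R .var) a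
      ((HornFormula.holds_rel ..).2 ⟨_, fun j => (Term.mem_eval_var ..).2 rfl, ha ()⟩)
    obtain ⟨b, hb, hy⟩ := (HornFormula.holds_rel ..).1 this
    obtain rfl : b = a := funext fun j => (Term.mem_eval_var ..).1 (hb j)
    exact hy

end PartialHorn

theorem mainTheorem11 {κ : Cardinal.{w}} [Fact κ.IsRegular] {S : Type w}
    (Sig : PartialHorn.Signature κ S) (T : PartialHorn.Theory Sig) :
    PartialHorn.IsPresentableProperFactorizationSystem κ
      (PartialHorn.dense T) (PartialHorn.closedMono T) where
  left_comp := ⟨PartialHorn.dense_comp⟩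
  right_comp := ⟨PartialHorn.closedMono_comp⟩
  left_iso _ _ h (_ : CategoryTheory.IsIso h) := PartialHorn.dense_of_isIso h
  right_iso _ _ h (_ : CategoryTheory.IsIso h) := PartialHorn.closedMono_of_isIso h
  factorization _ _ := PartialHorn.exists_dense_closedMono
  orthogonal _ _ _ _ := PartialHorn.orthogonal_dense_closedMono
  epi _ _ := PartialHorn.epi_of_dense
  mono _ _ _ h := h.1
  presentable _ _ := PartialHorn.closedMono_of_rightOrthogonal
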